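/- Let $m$ be an odd positive integer, let $R=\sum_{i=0}^d a_ix^{2^i}\in\mathbb F_{2^m}[x]$ with $a_d\neq 0$, and set $f(x)=xR(x)$. For $n\ge 1$ let $q_n:=\mathrm{Tr}_{\mathbb F_{2^{mn}}/\mathbb F_2}\circ f$, a quadratic form on the $\mathbb F_2$-vector space $\mathbb F_{2^{mn}}$, and let $\varepsilon_n(f):=\varepsilon(q_n)$. Here, for a quadratic form $q$ on a finite-dimensional $\mathbb F_2$-vector space, $\varepsilon(q)$ is $0$, $1$ or $-1$ according to whether, in the coordinates of a suitable basis $(e_1,\dots,e_k)$ and for a suitable even $r\le k$, $q$ can be written respectively as (i) $x_1x_2+\cdots+x_{r-1}x_r+x_{r+1}^2$ (with $r<k$), (ii) $x_1x_2+\cdots+x_{r-1}x_r$, or (iii) $x_1^2+x_1x_2+x_2^2+x_3x_4+\cdots+x_{r-1}x_r$ (with $r\ge 2$) (exactly one of the three occurs). Let $$\widetilde R:=\sum_{i=0}^d \left(a_i^{2^d}x^{2^{d+i}}+a_i^{2^{d-i}}x^{2^{d-i}}\right),$$ let $N$ be the degree over $\mathbb F_{2^m}$ of the splitting field of $\widetilde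 R$ (so $N=1$ if $\widetilde R=0$), and write $N=2^bN'$ with $N'$ odd. Let $\chi$ be the Dirichlet character of modulus $8$ with $\chi(3)=\chi(5)=-1$. Then for every odd integer $n\ge 1$, $$\varepsilon_n(f)=\chi\bigl(n\gcd(n,N')\bigr)\,\varepsilon_{\gcd(n,N')}(f).$$ -/

import Mathlib

open Polynomial

/-- The quadratic form `q` over `𝔽₂` can be written `x₁x₂ + ⋯ + x_{r-1}x_r + x_{r+1}²` (`r = 2s`) in
some basis; the pairs `(x_{2i-1}, x_{2i})` are indexed by `Fin s`, and the `c + 1` basis vectors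
indexed by `Fin (c + 1)` span the radical of the polarisation. -/
def IsParabolicType {V : Type*} [AddCommGroup V] [Module (ZMod 2) V]
    (q : QuadraticForm (ZMod 2) V) : Prop :=
  ∃ (s c : ℕ) (e : Module.Basis ((Fin s × Fin 2) ⊕ Fin (c + 1)) (ZMod 2) V), ∀ v : V,
    q v = (∑ i : Fin s, e.repr v (Sum.inl (i, 0)) * e.repr v (Sum.inl (i, 1)))
      + e.repr v (Sum.inr 0) ^ 2

/-- The quadratic form `q` over `𝔽₂` can be written `x₁x₂ + ⋯ + x_{r-1}x_r` (`r = 2s`) in some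
basis; the `c` basis vectors indexed by `Fin c` span the radical of the polarisation. -/
def IsHyperbolicType {V : Type*} [AddCommGroup V] [Module (ZMod 2) V]
    (q : QuadraticForm (ZMod 2) V) : Prop :=
  ∃ (s c : ℕ) (e : Module.Basis ((Fin s × Fin 2) ⊕ Fin c) (ZMod 2) V), ∀ v : V,
    q v = ∑ i : Fin s, e.repr v (Sum.inl (i, 0)) * e.repr v (Sum.inl (i, 1))

/-- The quadratic form `q` over `𝔽₂` can be written `x₁² + x₁x₂ + x₂² + x₃x₄ + ⋯ + x_{r-1}x_r`
(`r = 2(s + 1)`) in some basis; the `c` basis vectors indexed by `Fin c` span the radical of the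
polarisation. -/
def IsEllipticType {V : Type*} [AddCommGroup V] [Module (ZMod 2) V]
    (q : QuadraticForm (ZMod 2) V) : Prop :=
  ∃ (s c : ℕ) (e : Module.Basis ((Fin (s + 1) × Fin 2) ⊕ Fin c) (ZMod 2) V), ∀ v : V,
    q v = e.repr v (Sum.inl (0, 0)) ^ 2 + e.repr v (Sum.inl (0, 1)) ^ 2
      + ∑ i : Fin (s + 1), e.repr v (Sum.inl (i, 0)) * e.repr v (Sum.inl (i, 1))

open Classical in
/-- The invariant `ε(q)` of a quadratic form over `𝔽₂`: it is `0`, `1`, `-1` according to which of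
the three normal forms `q` has. (On a finite-dimensional space exactly one of the three
alternatives holds; the last `0` is never reached there.) -/
noncomputable def quadInvariant {V : Type*} [AddCommGroup V] [Module (ZMod 2) V]
    (q : QuadraticForm (ZMod 2) V) : ℤ :=
  if IsParabolicType q then 0
  else if IsHyperbolicType q then 1
  else if IsEllipticType q then -1
  else 0

/-- The `2`-linearized polynomial `R = ∑_{i=0}^d a_i x^{2^i}`. -/
noncomputable def linearizedPoly {K : Type*} [Field K] (d : ℕ) (a : ℕ → K) : K[X] :=
  ∑ i ∈ Finset.range (d + 1), C (a i) * X ^ (2 ^ i)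

/-- The kernel polynomial
`R~ = ∑_{i=0}^d (a_i^{2^d} x^{2^{d+i}} + a_i^{2^{d-i}} x^{2^{d-i}})`. -/
noncomputable def kernelPoly {K : Type*} [Field K] (d : ℕ) (a : ℕ → K) : K[X] :=
  ∑ i ∈ Finset.range (d + 1),
    (C (a i ^ 2 ^ d) * X ^ (2 ^ (d + i)) + C (a i ^ 2 ^ (d - i)) * X ^ (2 ^ (d - i)))

/-- The degree `N` over `K` of the decomposition (splitting) field of the kernel polynomial. -/
noncomputable def kernelDegree {K : Type*} [Field K] (d : ℕ) (a : ℕ → K) : ℕ :=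
  Module.finrank K (kernelPoly d a).SplittingField

theorem aeval_linearizedPoly_add {K : Type*} [Field K] (d : ℕ) (a : ℕ → K)
    (L : Type*) [Field L] [Algebra K L] [Algebra (ZMod 2) L] (x y : L) :
    aeval (x + y) (linearizedPoly d a)
      = aeval x (linearizedPoly d a) + aeval y (linearizedPoly d a) := by
  have : CharP L 2 := charP_of_injective_algebraMap (algebraMap (ZMod 2) L).injective 2
  simp only [linearizedPoly, map_sum, map_mul, aeval_C, map_pow, aeval_X, add_pow_char_pow,
    mul_add, Finset.sum_add_distrib]

theorem zmod_two_eq_zero_or_one (c : ZMod 2) : c = 0 ∨ c = 1 := by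
  revert c; decide

theorem aeval_linearizedPoly_zero {K : Type*} [Field K] (d : ℕ) (a : ℕ → K)
    (L : Type*) [Field L] [Algebra K L] :
    aeval (0 : L) (linearizedPoly d a) = 0 := by
  simp [linearizedPoly]

/-- For an extension `L` of `K`, the quadratic form `x ↦ Tr_{L/𝔽₂}(f(x))` on the `𝔽₂`-vector space
`L`, where `f(x) = x R(x)`. -/
noncomputable def traceForm {K : Type*} [Field K] (d : ℕ) (a : ℕ → K)
    (L : Type*) [Field L] [Algebra K L] [Algebra (ZMod 2) L] : QuadraticForm (ZMod 2) L :=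
  QuadraticMap.ofPolar
    (fun x : L => Algebra.trace (ZMod 2) L (aeval x (X * linearizedPoly d a)))
    (by
      intro c x
      rcases zmod_two_eq_zero_or_one c with rfl | rfl <;> simp)
    (by
      intro x x' y
      simp only [QuadraticMap.polar, map_mul, aeval_X, aeval_linearizedPoly_add, add_mul, mul_add,
        map_add]
      ring)
    (by
      intro c x y
      rcases zmod_two_eq_zero_or_one c with rfl | rfl <;> simp [QuadraticMap.polar])

/-- The invariant `ε_n(f)`, `f(x) = x R(x)`, where `n` is the degree of `L` over `K`. -/
noncomputable def epsilonInv {K : Type*} [Field K] (d : ℕ) (a : ℕ → K)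
    (L : Type*) [Field L] [Algebra K L] [Algebra (ZMod 2) L] : ℤ :=
  quadInvariant (traceForm d a L)

/-!
Write `S(q) = ∑_v (-1)^{q(v)}`. The classification of quadratic forms over `𝔽₂`
(`isParabolicType_or_isHyperbolicType_or_isEllipticType`) shows that `S(q) = ε(q) 2^j` for some `j`,
so `ε(q)` is the sign of `S(q)`. The theorem is therefore a comparison of the signs of exponential
sums, and the multiplicativity of `χ` reduces it to one extension `L/E` of odd prime degree `p`, in
which `[E : K]` is still a multiple of `gcd(n, N')`.

The polar form of `Tr(x R(x))` is `Tr(x^{2^d} R~(y))` (`polar_traceForm`), so its radical consists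
of the zeros of `R~`. A zero in `L` has a degree dividing both `[L : K]` and `N`, hence dividing
`gcd(n, N')`, and so lies in `E` (`mem_range_algebraMap_of_aeval_eq_zero`). As `p` is odd, the
form of `L` restricts to the form of `E`. The square `S(q)²` is the number of vectors times the
sum of `(-1)^{q(z)}` over the radical (`expSum_sq`); this gives `S_L² = |E|^{p-1} S_E²`, that is,
`S_L = ± |E|^{(p-1)/2} S_E`. On the other hand, the Galois group of `L/E` has order `p`, leaves
the form invariant and has the fixed points `E`, so `S_L ≡ S_E` modulo `p`
(`expSum_modEq_expSum_fixedPoints`). Since `|E|` is an odd power of `2`, Euler's criterion gives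
`|E|^{(p-1)/2} ≡ χ(p)` modulo `p`, so the sign is `χ(p)` (`sign_eq_chi_mul_sign`). The radical is
controlled only when `R~ ≠ 0`; otherwise `d = 0`, the forms are nonzero linear forms, and all
invariants vanish.
-/

/-! ### Exponential sums of quadratic forms over `𝔽₂` -/

/-- The exponential sum `∑_v (-1)^{q(v)}` of a function with values in `𝔽₂`. -/
def expSum {V : Type*} [Fintype V] (q : V → ZMod 2) : ℤ :=
  ∑ v, (-1) ^ (q v).val

theorem neg_one_pow_val_add (c c' : ZMod 2) :
    (-1 : ℤ) ^ (c + c').val = (-1) ^ c.val * (-1) ^ c'.val := by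
  revert c c'; decide

theorem neg_one_pow_val_sum {ι : Type*} (s : Finset ι) (g : ι → ZMod 2) :
    (-1 : ℤ) ^ (∑ i ∈ s, g i).val = ∏ i ∈ s, (-1) ^ (g i).val := by
  classical
  induction s using Finset.induction_on with
  | empty => simp
  | insert i s hi ih => rw [Finset.sum_insert hi, Finset.prod_insert hi, neg_one_pow_val_add, ih]

/-- An exponential sum vanishes if some translation changes the sign of every term. -/
theorem expSum_eq_zero_of_add {V : Type*} [Fintype V] [AddGroup V] {q : V → ZMod 2} (e : V)
    (h : ∀ v, q (v + e) = q v + 1) : expSum q = 0 := by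
  have h1 : expSum q = -expSum q := by
    calc expSum q = ∑ v, (-1) ^ (q (v + e)).val :=
          (Equiv.sum_comp (Equiv.addRight e) fun v ↦ (-1 : ℤ) ^ (q v).val).symm
      _ = -expSum q := by
          rw [expSum, ← Finset.sum_neg_distrib]
          refine Finset.sum_congr rfl fun v _ ↦ ?_
          rw [h, neg_one_pow_val_add]
          simp [ZMod.val_one]
  lia

theorem expSum_comp_equiv {V W : Type*} [Fintype V] [Fintype W] (e : V ≃ W) (q : W → ZMod 2) :
    expSum (fun v ↦ q (e v)) = expSum q :=
  e.sum_comp fun w ↦ (-1 : ℤ) ^ (q w).val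

/-- The exponential sum of an orthogonal sum of planes and of a totally singular space is the
product of the exponential sums of its summands. -/
theorem expSum_eq_prod {V ι κ : Type*} [AddCommGroup V] [Module (ZMod 2) V] [Fintype V]
    [Fintype ι] [Fintype κ] (e : Module.Basis ((ι × Fin 2) ⊕ κ) (ZMod 2) V)
    (t : ι → (Fin 2 → ZMod 2) → ZMod 2) (q : V → ZMod 2)
    (hq : ∀ v, q v = ∑ i, t i fun j ↦ e.repr v (Sum.inl (i, j))) :
    expSum q = 2 ^ Fintype.card κ * ∏ i, expSum (t i) := by
  classical
  let φ : V ≃ (ι → Fin 2 → ZMod 2) × (κ → ZMod 2) :=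
    e.equivFun.toEquiv.trans ((Equiv.sumArrowEquivProdArrow _ _ _).trans
      ((Equiv.curry _ _ _).prodCongr (Equiv.refl _)))
  calc expSum q = ∑ v, ∏ i, (-1 : ℤ) ^ (t i ((φ v).1 i)).val :=
        Finset.sum_congr rfl fun v _ ↦ by rw [hq, neg_one_pow_val_sum]; rfl
    _ = ∑ z : (ι → Fin 2 → ZMod 2) × (κ → ZMod 2), ∏ i, (-1 : ℤ) ^ (t i (z.1 i)).val :=
        φ.sum_comp fun z ↦ ∏ i, (-1 : ℤ) ^ (t i (z.1 i)).val
    _ = 2 ^ Fintype.card κ * ∏ i, expSum (t i) := by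
        simp only [expSum]
        rw [Fintype.sum_prod_type, Finset.prod_univ_sum, Fintype.piFinset_univ, Finset.mul_sum]
        simp

/-! ### Classification over `𝔽₂` -/

section Classification

variable {V : Type*} [AddCommGroup V] [Module (ZMod 2) V] {q : QuadraticForm (ZMod 2) V}

theorem IsParabolicType.expSum_eq_zero [Fintype V] (h : IsParabolicType q) : expSum q = 0 := by
  obtain ⟨s, c, e, h⟩ := h
  refine expSum_eq_zero_of_add (e (Sum.inr 0)) fun v ↦ ?_
  have h2 : ∀ z : ZMod 2, (z + 1) ^ 2 = z ^ 2 + 1 := by decide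
  simp [h, h2, add_assoc]

theorem IsHyperbolicType.expSum_eq [Fintype V] (h : IsHyperbolicType q) :
    ∃ j : ℕ, expSum q = 2 ^ j := by
  obtain ⟨s, c, e, h⟩ := h
  have h2 : expSum (fun g : Fin 2 → ZMod 2 ↦ g 0 * g 1) = 2 := by decide
  refine ⟨c + s, ?_⟩
  rw [expSum_eq_prod e (fun _ g ↦ g 0 * g 1) q h, h2]
  simp [pow_add]

theorem IsEllipticType.expSum_eq [Fintype V] (h : IsEllipticType q) :
    ∃ j : ℕ, expSum q = -2 ^ j := by
  obtain ⟨s, c, e, h⟩ := h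
  have h2 : expSum (fun g : Fin 2 → ZMod 2 ↦ g 0 * g 1) = 2 := by decide
  have h3 : expSum (fun g : Fin 2 → ZMod 2 ↦ g 0 ^ 2 + g 1 ^ 2 + g 0 * g 1) = -2 := by decide
  refine ⟨c + (s + 1), ?_⟩
  rw [expSum_eq_prod e (Fin.cons (fun g ↦ g 0 ^ 2 + g 1 ^ 2 + g 0 * g 1) fun _ g ↦ g 0 * g 1) q,
    Fin.prod_univ_succ]
  · simp only [Fin.cons_zero, Fin.cons_succ, h2, h3, Finset.prod_const, Finset.card_univ,
      Fintype.card_fin]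
    ring
  · intro v
    rw [h, Fin.sum_univ_succ, Fin.sum_univ_succ]
    simp [add_assoc]

/-- A plane on which the polar form does not vanish splits off: bases of its orthogonal complement
`W` extend to bases of `V`, the new pair of coordinates being placed last. -/
theorem exists_orthogonal_splitting [FiniteDimensional (ZMod 2) V] {x y : V}
    (hxy : QuadraticMap.polar q x y = 1) :
    ∃ W : Submodule (ZMod 2) V, Module.finrank (ZMod 2) W < Module.finrank (ZMod 2) V ∧
      (∀ w ∈ W, QuadraticMap.polar q x w = 0 ∧ QuadraticMap.polar q y w = 0) ∧
      ∀ {s : ℕ} {κ : Type} (e : Module.Basis ((Fin s × Fin 2) ⊕ κ) (ZMod 2) W),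
        ∃ e' : Module.Basis ((Fin (s + 1) × Fin 2) ⊕ κ) (ZMod 2) V, ∀ v, ∃ w : W,
          q v = e'.repr v (Sum.inl (Fin.last s, 0)) ^ 2 * q x
              + e'.repr v (Sum.inl (Fin.last s, 1)) ^ 2 * q y
              + e'.repr v (Sum.inl (Fin.last s, 0)) * e'.repr v (Sum.inl (Fin.last s, 1))
              + q w ∧
          (∀ i j, e'.repr v (Sum.inl (Fin.castSucc i, j)) = e.repr w (Sum.inl (i, j))) ∧
          ∀ k, e'.repr v (Sum.inr k) = e.repr w (Sum.inr k) := by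
  have h2 : ∀ z : ZMod 2, z + z = 0 := by decide
  have h2V : ∀ v : V, v + v = 0 := fun v ↦ by
    rw [← two_smul (ZMod 2) v, show (2 : ZMod 2) = 0 from rfl, zero_smul]
  have hself : ∀ v, q.polarBilin v v = 0 := fun v ↦ by
    rw [QuadraticMap.polarBilin_apply_apply, QuadraticMap.polar_self, two_smul, h2]
  have hx1 : q.polarBilin x y = 1 := hxy
  have hy1 : q.polarBilin y x = 1 := by
    rw [QuadraticMap.polarBilin_apply_apply, QuadraticMap.polar_comm]; exact hxy
  let W : Submodule (ZMod 2) V := LinearMap.ker (q.polarBilin x) ⊓ LinearMap.ker (q.polarBilin y)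
  have hW : ∀ w ∈ W, q.polarBilin x w = 0 ∧ q.polarBilin y w = 0 := fun w hw ↦ hw
  -- As `polar x y = 1`, pairing with `y` reads off the coefficient of `x`, and conversely; the
  -- projection to `W` subtracts, which is the same as adding in characteristic two.
  let φ : V ≃ₗ[ZMod 2] (ZMod 2 × ZMod 2) × W :=
    { toFun := fun v ↦ ((q.polarBilin y v, q.polarBilin x v),
        ⟨v + q.polarBilin y v • x + q.polarBilin x v • y, by
          constructor <;>
          simp only [LinearMap.mem_ker, SetLike.mem_coe, map_add, map_smul, hself, hx1, hy1,
            smul_eq_mul, mul_zero, mul_one, add_zero, h2]⟩)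
      map_add' := fun v v' ↦ by
        ext <;> simp only [map_add, Prod.fst_add, Prod.snd_add, Submodule.coe_add, add_smul]
        abel
      map_smul' := fun c v ↦ by
        ext <;> simp [smul_smul]
      invFun := fun z ↦ z.1.1 • x + z.1.2 • y + z.2
      left_inv := fun v ↦ by
        have h (a b : V) : a + b + (v + a + b) = v + (a + a) + (b + b) := by abel
        simp only [h, h2V, add_zero]
      right_inv := fun ⟨⟨a, b⟩, w⟩ ↦ by
        obtain ⟨hw1, hw2⟩ := hW w w.2
        have h (a b w : V) : a + b + w + a + b = w + (a + a) + (b + b) := by abel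
        ext <;> simp [-QuadraticMap.polarBilin_apply_apply, hself, hx1, hy1, hw1, hw2, h, h2V] }
  refine ⟨W, ?_, hW, fun {s κ} e ↦ ?_⟩
  · rw [φ.finrank_eq, Module.finrank_prod, Module.finrank_prod, Module.finrank_self]
    lia
  · let σ : Fin 2 ⊕ ((Fin s × Fin 2) ⊕ κ) → (Fin (s + 1) × Fin 2) ⊕ κ :=
      Sum.elim (fun j ↦ Sum.inl (Fin.last s, j))
        (Sum.elim (fun z ↦ Sum.inl (Fin.castSucc z.1, z.2)) Sum.inr)
    have hσ : Function.Bijective σ := by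
      constructor
      · rintro (j | ⟨i, j⟩ | k) (j' | ⟨i', j'⟩ | k') h <;>
          simp_all [σ, Fin.castSucc_ne_last, (Fin.castSucc_ne_last _).symm]
      · rintro (⟨i, j⟩ | k)
        · induction i using Fin.lastCases with
          | last => exact ⟨Sum.inl j, rfl⟩
          | cast i => exact ⟨Sum.inr (Sum.inl (i, j)), rfl⟩
        · exact ⟨Sum.inr (Sum.inr k), rfl⟩
    let b := ((Module.Basis.finTwoProd (ZMod 2)).prod e).map φ.symm
    let e' := b.reindex (Equiv.ofBijective σ hσ)
    have hrepr : ∀ v z, e'.repr v (σ z) = b.repr v z := fun v z ↦ by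
      rw [Module.Basis.repr_reindex_apply]
      congr 1
      rw [Equiv.symm_apply_eq]
      rfl
    have h0 : ∀ v, e'.repr v (Sum.inl (Fin.last s, 0)) = (φ v).1.1 := fun v ↦
      (hrepr v (Sum.inl 0)).trans (by simp [b])
    have h1 : ∀ v, e'.repr v (Sum.inl (Fin.last s, 1)) = (φ v).1.2 := fun v ↦
      (hrepr v (Sum.inl 1)).trans (by simp [b])
    refine ⟨e', fun v ↦ ⟨(φ v).2, ?_, fun i j ↦ ?_, fun k ↦ ?_⟩⟩
    · rw [h0, h1]
      obtain ⟨hw1, hw2⟩ := hW (φ v).2 (φ v).2.2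
      conv_lhs => rw [← φ.symm_apply_apply v]
      change q ((φ v).1.1 • x + (φ v).1.2 • y + ((φ v).2 : V)) = _
      generalize (φ v).1.1 = c at *
      generalize (φ v).1.2 = c' at *
      have hadd : ∀ u u', q (u + u') = q u + q u' + q.polarBilin u u' := fun u u' ↦ by
        rw [QuadraticMap.polarBilin_apply_apply, QuadraticMap.map_add q]
      rw [hadd, hadd]
      simp [-QuadraticMap.polarBilin_apply_apply, QuadraticMap.map_smul, hw1, hw2, hx1]
      have hidem : ∀ c : ZMod 2, c * c = c := by decide
      rw [hidem, hidem]
      ring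
    · exact (hrepr v (Sum.inr (Sum.inl (i, j)))).trans (by simp [b])
    · exact (hrepr v (Sum.inr (Sum.inr k))).trans (by simp [b])

/-- Every quadratic form whose polar form vanishes is a linear form, hence of parabolic or of
hyperbolic type with no pairs of coordinates. -/
theorem isParabolicType_or_isHyperbolicType_of_polar_eq_zero [FiniteDimensional (ZMod 2) V]
    (h : ∀ x y, QuadraticMap.polar q x y = 0) : IsParabolicType q ∨ IsHyperbolicType q := by
  let l : V →ₗ[ZMod 2] ZMod 2 :=
    { toFun := q
      map_add' := fun x y ↦ by rw [QuadraticMap.map_add q, h, add_zero]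
      map_smul' := fun c x ↦ by
        rcases zmod_two_eq_zero_or_one c with rfl | rfl <;> simp }
  have hl : ∀ v, q v = l v := fun _ ↦ rfl
  by_cases h0 : ∃ y, l y = 1
  · obtain ⟨y, hy⟩ := h0
    left
    let b := Module.finBasis (ZMod 2) (LinearMap.ker l)
    let B := Module.Basis.mkFinCons y b (fun c x hx hc ↦ by
      have := congrArg l hc
      simpa [hy, LinearMap.mem_ker.1 hx] using this) (fun z ↦ ⟨l z, by
        rw [LinearMap.mem_ker, map_add, map_smul, hy, smul_eq_mul, mul_one]
        exact CharTwo.add_self_eq_zero _⟩)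
    refine ⟨0, _, B.reindex (Equiv.emptySum _ _).symm, fun v ↦ ?_⟩
    have h2 : ∀ z : ZMod 2, z ^ 2 = z := by decide
    have hB : ∀ i, l (B (Fin.succ i)) = 0 := fun i ↦ by
      simp only [B, Module.Basis.coe_mkFinCons, Fin.cons_succ]
      exact (b i).2
    have hB0 : l (B 0) = 1 := by simpa [B] using hy
    rw [hl, h2, ← B.sum_repr v, map_sum, Fin.sum_univ_succ]
    simp [hB, hB0]
  · right
    refine ⟨0, _, (Module.finBasis (ZMod 2) V).reindex (Equiv.emptySum _ _).symm, fun v ↦ ?_⟩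
    have := (zmod_two_eq_zero_or_one (l v)).resolve_right fun hv ↦ h0 ⟨v, hv⟩
    simp [hl, this]

/-- Every quadratic form over `𝔽₂` has one of the three normal forms. -/
theorem isParabolicType_or_isHyperbolicType_or_isEllipticType {V : Type*} [AddCommGroup V]
    [Module (ZMod 2) V] [FiniteDimensional (ZMod 2) V] (q : QuadraticForm (ZMod 2) V) :
    IsParabolicType q ∨ IsHyperbolicType q ∨ IsEllipticType q := by
  induction hk : Module.finrank (ZMod 2) V using Nat.strong_induction_on generalizing V with
  | _ k ih =>
  have h01 := zmod_two_eq_zero_or_one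
  have h2 : ∀ z : ZMod 2, z + z = 0 := by decide
  by_cases hx : ∃ x y, q x = 0 ∧ QuadraticMap.polar q x y = 1
  · -- A hyperbolic plane splits off, and the induction hypothesis applies to its complement.
    obtain ⟨x, y, hqx, hxy⟩ := hx
    obtain ⟨y, hqy, hxy⟩ : ∃ y, q y = 0 ∧ QuadraticMap.polar q x y = 1 := by
      rcases h01 (q y) with hy | hy
      · exact ⟨y, hy, hxy⟩
      · -- `q (y + x) = q y + q x + polar x y = 1 + 0 + 1`
        refine ⟨y + x, ?_, ?_⟩
        · rw [QuadraticMap.map_add q, QuadraticMap.polar_comm, hqx, hxy, hy, add_zero, h2]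
        · rw [QuadraticMap.polar_add_right, hxy, QuadraticMap.polar_self, hqx, smul_zero, add_zero]
    obtain ⟨W, hWk, -, hW⟩ := exists_orthogonal_splitting hxy
    have hq : ∀ w : W, q.restrict W w = q w := fun _ ↦ rfl
    rcases ih _ (hk ▸ hWk) (q.restrict W) rfl with ⟨s, c, e, he⟩ | ⟨s, c, e, he⟩ | ⟨s, c, e, he⟩
    · obtain ⟨e', he'⟩ := hW e
      refine .inl ⟨s + 1, c, e', fun v ↦ ?_⟩
      obtain ⟨w, hv, h1, h2⟩ := he' v
      rw [hv, ← hq, he, Fin.sum_univ_castSucc, hqx, hqy]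
      simp only [h1, h2]
      ring
    · obtain ⟨e', he'⟩ := hW e
      refine .inr (.inl ⟨s + 1, c, e', fun v ↦ ?_⟩)
      obtain ⟨w, hv, h1, h2⟩ := he' v
      rw [hv, ← hq, he, Fin.sum_univ_castSucc, hqx, hqy]
      simp only [h1]
      ring
    · obtain ⟨e', he'⟩ := hW e
      refine .inr (.inr ⟨s + 1, c, e', fun v ↦ ?_⟩)
      obtain ⟨w, hv, h1, h2⟩ := he' v
      rw [hv, ← hq, he, Fin.sum_univ_castSucc (n := s + 1), hqx, hqy,
        show (0 : Fin (s + 1 + 1)) = Fin.castSucc 0 from rfl]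
      simp only [h1]
      ring
  · push Not at hx
    -- Now `q x = 1` for every `x` outside the radical.
    by_cases hp : ∃ x y, QuadraticMap.polar q x y = 1
    · -- For `w` in the complement of a plane, `x + w` is outside the radical, so `q w = 0`.
      right; right
      obtain ⟨x, y, hxy⟩ := hp
      have hq1 : ∀ x y, QuadraticMap.polar q x y = 1 → q x = 1 := fun x y h ↦
        (h01 _).resolve_left fun h0 ↦ hx x y h0 h
      obtain ⟨W, -, hWp, hW⟩ := exists_orthogonal_splitting hxy
      have hqW : ∀ w ∈ W, q w = 0 := fun w hw ↦ by
        obtain ⟨h1, h2⟩ := hWp w hw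
        have h3 : q (x + w) = 1 := hq1 (x + w) y (by
          rw [QuadraticMap.polar_add_left, hxy, QuadraticMap.polar_comm, h2, add_zero])
        rw [QuadraticMap.map_add q, h1, hq1 x y hxy] at h3
        simpa using h3
      obtain ⟨e', he'⟩ := hW
        ((Module.finBasis (ZMod 2) W).reindex (Equiv.emptySum (Fin 0 × Fin 2) _).symm)
      refine ⟨0, _, e', fun v ↦ ?_⟩
      obtain ⟨w, hv, -, -⟩ := he' v
      rw [hv, hqW w w.2, hq1 x y hxy, hq1 y x (by rw [QuadraticMap.polar_comm, hxy])]
      simp [Fin.last]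
    · push Not at hp
      have := isParabolicType_or_isHyperbolicType_of_polar_eq_zero (q := q) fun x y ↦
        (h01 _).resolve_right (hp x y)
      tauto

/-- The invariant of a quadratic form is the sign of its exponential sum, whose absolute value is a
power of two unless it vanishes. -/
theorem exists_expSum_eq_quadInvariant_mul [Fintype V] (q : QuadraticForm (ZMod 2) V) :
    ∃ j : ℕ, expSum q = quadInvariant q * 2 ^ j := by
  classical
  have : FiniteDimensional (ZMod 2) V := .of_finite
  rw [quadInvariant]
  split_ifs with h1 h2 h3
  · exact ⟨0, by simp [h1.expSum_eq_zero]⟩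
  · simpa using h2.expSum_eq
  · simpa using h3.expSum_eq
  · exact absurd (isParabolicType_or_isHyperbolicType_or_isEllipticType q) (by tauto)

theorem quadInvariant_eq_sign_expSum [Fintype V] (q : QuadraticForm (ZMod 2) V) :
    quadInvariant q = (expSum q).sign := by
  obtain ⟨j, hj⟩ := exists_expSum_eq_quadInvariant_mul q
  rw [hj, Int.sign_mul, Int.sign_eq_one_of_pos (a := 2 ^ j) (by positivity), mul_one]
  rw [quadInvariant]
  split_ifs <;> rfl

/-- The square of the exponential sum only depends on the radical of the polar form and on the
values of the form there. -/
theorem expSum_sq [Fintype V] (q : QuadraticForm (ZMod 2) V) [DecidableEq V]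
    (S : Finset V) (hS : ∀ y, y ∈ S ↔ ∀ x, QuadraticMap.polar q x y = 0) :
    expSum q ^ 2 = Fintype.card V * ∑ y ∈ S, (-1) ^ (q y).val := by
  calc expSum q ^ 2
      = ∑ x, ∑ y, (-1) ^ (q x).val * (-1) ^ (q y).val := by
        rw [sq, expSum, Finset.sum_mul_sum]
    _ = ∑ x, ∑ y, (-1) ^ (q x).val * (-1) ^ (q (x + y)).val :=
        Finset.sum_congr rfl fun x _ ↦ (Equiv.sum_comp (Equiv.addLeft x) fun y ↦
          (-1 : ℤ) ^ (q x).val * (-1) ^ (q y).val).symm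
    _ = ∑ y, (-1) ^ (q y).val * expSum (fun x ↦ QuadraticMap.polar q x y) := by
        rw [Finset.sum_comm]
        refine Finset.sum_congr rfl fun y _ ↦ ?_
        rw [expSum, Finset.mul_sum]
        refine Finset.sum_congr rfl fun x _ ↦ ?_
        rw [← neg_one_pow_val_add, ← neg_one_pow_val_add, QuadraticMap.map_add q]
        congr 2
        generalize q x = a
        generalize q y = b
        generalize QuadraticMap.polar q x y = c
        revert a b c
        decide
    _ = ∑ y ∈ S, (-1 : ℤ) ^ (q y).val * Fintype.card V := by
        rw [← Finset.sum_subset (Finset.subset_univ S)]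
        · refine Finset.sum_congr rfl fun y hy ↦ ?_
          simp [expSum, (hS y).1 hy]
        · intro y _ hy
          rw [hS] at hy
          push Not at hy
          obtain ⟨x, hx⟩ := hy
          rw [expSum_eq_zero_of_add x fun v ↦ ?_, mul_zero]
          rw [QuadraticMap.polar_add_left, (zmod_two_eq_zero_or_one _).resolve_left hx]
    _ = Fintype.card V * ∑ y ∈ S, (-1) ^ (q y).val := by
        rw [← Finset.sum_mul, mul_comm]

end Classification

/-! ### Congruence modulo the order of a group acting by isometries -/

theorem expSum_eq_card_sub_card {V : Type*} [Fintype V] (q : V → ZMod 2) :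
    expSum q = (Nat.card {v // q v = 0} : ℤ) - Nat.card {v // q v = 1} := by
  have h : ∀ c : ZMod 2, (-1 : ℤ) ^ c.val = (if c = 0 then 1 else 0) - if c = 1 then 1 else 0 := by
    decide
  simp only [expSum, h, Finset.sum_sub_distrib, Finset.sum_boole, Nat.card_eq_fintype_card,
    Fintype.card_subtype]

/-- If a `p`-group acts on a finite set and leaves `q` invariant, then the exponential sum of `q` is
congruent modulo `p` to the sum over the fixed points, here the image of `i`. -/
theorem expSum_modEq_expSum_fixedPoints {p : ℕ} [Fact p.Prime] {G V W : Type*} [Group G]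
    (hG : IsPGroup p G) [MulAction G V] [Fintype V] [Fintype W] (q : V → ZMod 2)
    (hq : ∀ (g : G) v, q (g • v) = q v) (i : W → V) (hi : Function.Injective i)
    (hfix : ∀ v, v ∈ Set.range i ↔ ∀ g : G, g • v = v) :
    expSum q ≡ expSum (fun w ↦ q (i w)) [ZMOD p] := by
  have key : ∀ c : ZMod 2,
      (Nat.card {v // q v = c} : ℤ) ≡ Nat.card {w // q (i w) = c} [ZMOD p] := by
    intro c
    let S : SubMulAction G V := ⟨{v | q v = c}, fun g v hv ↦ (hq g v).trans hv⟩
    have h1 : Nat.card S ≡ Nat.card (MulAction.fixedPoints G S) [MOD p] :=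
      hG.card_modEq_card_fixedPoints S
    have h2 : Nat.card {w // q (i w) = c} = Nat.card (MulAction.fixedPoints G S) :=
      Nat.card_eq_of_bijective
        (fun w ↦ ⟨⟨i w, w.2⟩, fun g ↦ Subtype.ext ((hfix _).1 ⟨w, rfl⟩ g)⟩)
        ⟨fun w w' h ↦ Subtype.ext (hi (congrArg (fun z ↦ (z.1.1 : V)) h)), fun ⟨⟨v, hv⟩, h⟩ ↦ by
          obtain ⟨w, rfl⟩ := (hfix v).2 fun g ↦ congrArg Subtype.val (h g)
          exact ⟨⟨w, hv⟩, rfl⟩⟩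
    rw [h2]
    exact Int.natCast_modEq_iff.2 h1
  rw [expSum_eq_card_sub_card, expSum_eq_card_sub_card]
  exact (key 0).sub (key 1)

/-- Two integers that are congruent modulo an odd prime `p`, whose squares have the ratio
`2 ^ (t * (p - 1))` with `t` odd, have signs that differ by the quadratic character of `2` modulo
`p`. That `T` is zero or `±2 ^ j` makes it invertible modulo `p` unless it vanishes. -/
theorem sign_eq_chi_mul_sign {p t j : ℕ} (hp : p.Prime) (hp2 : p ≠ 2) (ht : Odd t) {S T A : ℤ}
    (hS : S ^ 2 = (2 ^ t) ^ p * A) (hT : T ^ 2 = 2 ^ t * A) (hST : S ≡ T [ZMOD p])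
    (hTj : T = T.sign * 2 ^ j) :
    S.sign = ZMod.χ₈ p * T.sign := by
  have := Fact.mk hp
  obtain ⟨h, hh⟩ := hp.odd_of_ne_two hp2
  have hp3 : 3 ≤ p := by have := hp.two_le; lia
  set Q : ℤ := 2 ^ t with hQ
  have hsq : S ^ 2 = (Q ^ h * T) ^ 2 := by
    rw [hS, mul_pow, hT, hh]
    ring
  have hχ : (ZMod.χ₈ p : ℤ) = 1 ∨ (ZMod.χ₈ p : ℤ) = -1 := by
    rw [← legendreSym.at_two hp2]
    exact legendreSym.eq_one_or_neg_one p (by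
      have : ((2 : ℕ) : ZMod p) ≠ 0 := by
        rw [Ne, ZMod.natCast_eq_zero_iff]
        exact fun hd ↦ by have := Nat.le_of_dvd two_pos hd; lia
      exact_mod_cast this)
  -- Euler's criterion; as `t` is odd, the `t`-th power of `±1` is `±1` again.
  have hQh : Q ^ h ≡ ZMod.χ₈ p [ZMOD p] := by
    rw [← ZMod.intCast_eq_intCast_iff]
    have h1 := legendreSym.eq_pow p 2
    rw [legendreSym.at_two hp2, show p / 2 = h by lia] at h1
    calc ((Q ^ h : ℤ) : ZMod p) = (((2 : ℤ) : ZMod p) ^ h) ^ t := by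
          rw [hQ]; push_cast; rw [← pow_mul, ← pow_mul, mul_comm]
      _ = ((ZMod.χ₈ p : ℤ) : ZMod p) := by
          rw [← h1]
          rcases hχ with h | h <;> simp [h, ht.neg_one_pow]
  have hpos : 0 < Q ^ h := by positivity
  by_cases hT0 : T = 0
  · have : S = 0 := by simpa [hT0] using hsq
    simp [this, hT0]
  have hpT : ¬ (p : ℤ) ∣ T := by
    rw [hTj]
    intro hd
    rw [Int.natCast_dvd, Int.natAbs_mul, Int.natAbs_sign_of_ne_zero hT0, one_mul,
      Int.natAbs_pow] at hd
    have := Nat.le_of_dvd (by simp) (hp.dvd_of_dvd_pow hd)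
    simp at this
    lia
  have hδ : ∀ δ : ℤ, δ = 1 ∨ δ = -1 → S = δ * (Q ^ h * T) → δ = ZMod.χ₈ p := by
    intro δ hδ hSδ
    have h1 : (p : ℤ) ∣ T * (1 - δ * ZMod.χ₈ p) := by
      have h2 : T ≡ δ * (ZMod.χ₈ p * T) [ZMOD p] :=
        hST.symm.trans (hSδ ▸ (hQh.mul_right T).mul_left δ)
      rw [show T * (1 - δ * ZMod.χ₈ p) = T - δ * (ZMod.χ₈ p * T) by ring]
      exact h2.symm.dvd
    have h3 := ((Nat.prime_iff_prime_int.1 hp).dvd_or_dvd h1).resolve_left hpT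
    rcases hδ with rfl | rfl <;> rcases hχ with h | h <;> rw [h] at h3 ⊢ <;> norm_num at h3 <;>
      · have := Int.le_of_dvd (by norm_num) h3
        lia
  rcases sq_eq_sq_iff_eq_or_eq_neg.1 hsq with h1 | h1
  · rw [← hδ 1 (.inl rfl) (by rw [h1, one_mul]), h1, Int.sign_mul, Int.sign_eq_one_of_pos hpos]
  · rw [← hδ (-1) (.inr rfl) (by rw [h1, neg_one_mul]), h1, Int.sign_neg, Int.sign_mul,
      Int.sign_eq_one_of_pos hpos]
    ring

/-! ### The form `Tr(x R(x))` and its radical -/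

section TraceForm

variable {K : Type*} [Field K] {d : ℕ} {a : ℕ → K}

theorem traceForm_apply (L : Type*) [Field L] [Algebra K L] [Algebra (ZMod 2) L] (x : L) :
    traceForm d a L x = Algebra.trace (ZMod 2) L (x * aeval x (linearizedPoly d a)) := by
  change Algebra.trace (ZMod 2) L (aeval x (X * linearizedPoly d a)) = _
  rw [map_mul, aeval_X]

theorem trace_pow_two_pow {L : Type*} [Field L] [Algebra (ZMod 2) L] [Finite L] (z : L) (k : ℕ) :
    Algebra.trace (ZMod 2) L (z ^ 2 ^ k) = Algebra.trace (ZMod 2) L z := by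
  induction k with
  | zero => simp
  | succ k ih =>
    rw [pow_succ, pow_mul, ← ih]
    have := Algebra.trace_eq_of_algEquiv (FiniteField.frobeniusAlgEquivOfAlgebraic (ZMod 2) L)
      (z ^ 2 ^ k)
    simpa [ZMod.card] using this

/-- The polar form of `Tr(x R(x))`. The terms `Tr(y a_i x^{2^i})` and `Tr(x a_i y^{2^i})` are raised
to the powers `2^{d-i}` and `2^d`, which does not change the trace and makes `x` occur in both as
`x^{2^d}`. -/
theorem polar_traceForm {L : Type*} [Field L] [Algebra K L] [Algebra (ZMod 2) L] [Finite L]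
    (x y : L) :
    QuadraticMap.polar (traceForm d a L) x y
      = Algebra.trace (ZMod 2) L (x ^ 2 ^ d * aeval y (kernelPoly d a)) := by
  rw [QuadraticMap.polar, traceForm_apply, traceForm_apply, traceForm_apply, ← map_sub, ← map_sub,
    aeval_linearizedPoly_add]
  have h : (x + y) * (aeval x (linearizedPoly d a) + aeval y (linearizedPoly d a))
      - x * aeval x (linearizedPoly d a) - y * aeval y (linearizedPoly d a)
      = x * aeval y (linearizedPoly d a) + y * aeval x (linearizedPoly d a) := by ring
  rw [h]
  simp only [linearizedPoly, kernelPoly, map_sum, map_mul, map_add, aeval_C, map_pow, aeval_X,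
    Finset.mul_sum, ← Finset.sum_add_distrib, mul_add]
  refine Finset.sum_congr rfl fun i hi ↦ ?_
  have hid : i + (d - i) = d := by have := Finset.mem_range.1 hi; lia
  congr 1
  · rw [← trace_pow_two_pow _ d, mul_pow, mul_pow, ← pow_mul, ← pow_add, add_comm d i]
  · rw [← trace_pow_two_pow _ (d - i), mul_pow, mul_pow, ← pow_mul x, ← pow_add, hid]
    congr 1
    ring

theorem pow_two_pow_surjective {L : Type*} [Field L] [Algebra (ZMod 2) L] [Finite L] (k : ℕ) :
    Function.Surjective fun x : L ↦ x ^ 2 ^ k := by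
  have : CharP L 2 := charP_of_injective_algebraMap (algebraMap (ZMod 2) L).injective 2
  exact Finite.injective_iff_surjective.1 (iterateFrobenius_inj L 2 k)

/-- The radical of the polar form consists of the zeros of the kernel polynomial. -/
theorem polar_traceForm_eq_zero_iff {L : Type*} [Field L] [Algebra K L] [Algebra (ZMod 2) L]
    [Finite L] (y : L) :
    (∀ x, QuadraticMap.polar (traceForm d a L) x y = 0) ↔ aeval y (kernelPoly d a) = 0 := by
  simp only [polar_traceForm]
  refine ⟨fun h ↦ ?_, fun h x ↦ by rw [h, mul_zero, map_zero]⟩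
  refine (traceForm_nondegenerate (ZMod 2) L).2 _ fun z ↦ ?_
  obtain ⟨x, rfl⟩ := pow_two_pow_surjective d z
  exact h x

theorem kernelPoly_ne_zero (hd : d ≠ 0) (had : a d ≠ 0) : kernelPoly d a ≠ 0 := by
  intro h
  have h1 := congrArg (coeff · (2 ^ (d + d))) h
  simp only [kernelPoly, finsetSum_coeff, coeff_add, coeff_C_mul, coeff_X_pow, coeff_zero] at h1
  rw [Finset.sum_eq_single d] at h1
  · simp [hd, had] at h1
  · intro i hi hid
    have hi := Finset.mem_range.1 hi
    rw [if_neg, if_neg] <;> simp <;> lia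
  · simp

/-- If `R` is a monomial `a₀ x`, then `Tr(x R(x))` is a nonzero linear form. -/
theorem expSum_traceForm_zero {L : Type*} [Field L] [Algebra K L] [Algebra (ZMod 2) L]
    [Fintype L] (had : a 0 ≠ 0) : expSum (traceForm 0 a L) = 0 := by
  have : CharP L 2 := charP_of_injective_algebraMap (algebraMap (ZMod 2) L).injective 2
  have h0 : algebraMap K L (a 0) ≠ 0 := by simpa using had
  obtain ⟨z, hz⟩ := Algebra.trace_surjective (ZMod 2) L 1
  obtain ⟨e, he⟩ := pow_two_pow_surjective 1 ((algebraMap K L (a 0))⁻¹ * z)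
  refine expSum_eq_zero_of_add e fun v ↦ ?_
  simp only [traceForm_apply, linearizedPoly, zero_add, Finset.sum_range_one, pow_zero, pow_one,
    map_mul, aeval_C, aeval_X] at he ⊢
  have h2 : (v + e) * (algebraMap K L (a 0) * (v + e))
      = v * (algebraMap K L (a 0) * v) + algebraMap K L (a 0) * e ^ 2 := by
    rw [mul_left_comm, ← sq, CharTwo.add_sq]
    ring
  rw [h2, he, map_add, mul_inv_cancel_left₀ h0, hz]

theorem epsilonInv_eq_of_algEquiv {L L' : Type*} [Field L] [Algebra K L] [Algebra (ZMod 2) L]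
    [Field L'] [Algebra K L'] [Algebra (ZMod 2) L'] [Fintype L] [Fintype L'] (e : L ≃ₐ[K] L') :
    epsilonInv d a L = epsilonInv d a L' := by
  rw [epsilonInv, epsilonInv, quadInvariant_eq_sign_expSum, quadInvariant_eq_sign_expSum,
    ← expSum_comp_equiv e.toEquiv]
  congr 2
  funext x
  let e₂ : L ≃ₐ[ZMod 2] L' := AlgEquiv.ofRingEquiv (f := e.toRingEquiv) fun r ↦
    congrArg (fun f : ZMod 2 →+* L' ↦ f r)
      (Subsingleton.elim ((e : L →+* L').comp (algebraMap (ZMod 2) L)) (algebraMap (ZMod 2) L'))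
  change _ = traceForm d a L' (e x)
  rw [traceForm_apply, traceForm_apply, aeval_algHom_apply e x, ← map_mul]
  exact (Algebra.trace_eq_of_algEquiv e₂ _).symm

end TraceForm

/-! ### Zeros of a polynomial in extensions of finite fields -/

/-- A zero of `P ≠ 0` in `L` has a degree dividing `[L : K]` and the degree of every field `M` in
which `P` splits. If every such common divisor divides `[E : K]`, the zero comes from `E`. -/
theorem mem_range_algebraMap_of_aeval_eq_zero {K E L M : Type*} [Field K] [Field E] [Field L]
    [Field M] [Algebra K E] [Algebra K L] [Algebra K M] [Algebra E L]
    [IsScalarTower K E L] [Finite E] [FiniteDimensional K L] {P : K[X]} (hP : P ≠ 0)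
    (hM : (P.map (algebraMap K M)).Splits)
    (hE : ∀ k, k ∣ Module.finrank K L → k ∣ Module.finrank K M →
      k ∣ Module.finrank K E) {y : L} (hy : aeval y P = 0) :
    y ∈ Set.range (algebraMap E L) := by
  have : Finite K := Finite.of_injective _ (algebraMap K E).injective
  have := Fintype.ofFinite E
  have hint : IsIntegral K y := Algebra.IsIntegral.isIntegral y
  have hirr := minpoly.irreducible hint
  have hdvd : minpoly K y ∣ P := minpoly.dvd K y hy
  have h1 : (minpoly K y).natDegree ∣ Module.finrank K L := minpoly.degree_dvd hint
  have h2 : (minpoly K y).natDegree ∣ Module.finrank K M :=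
    hirr.natDegree_dvd_finrank (.of_dvd hM (map_ne_zero hP)
      (map_dvd (mapRingHom (algebraMap K M)) hdvd))
  have h3 := hirr.natDegree_dvd_iff_dvd_X_pow_card_pow_sub_X.1 (hE _ h1 h2)
  rw [← Module.natCard_eq_pow_finrank (V := E), ← Fintype.card_eq_nat_card] at h3
  have h4 : ((minpoly K y).map (algebraMap K E)).Splits :=
    .of_dvd (FiniteField.isSplittingField_sub E K).splits'
      (map_ne_zero (FiniteField.X_pow_card_sub_X_ne_zero K Fintype.one_lt_card))
      (map_dvd (mapRingHom (algebraMap K E)) h3)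
  refine h4.mem_range_of_isRoot (map_ne_zero (minpoly.ne_zero hint)) ?_
  rw [Polynomial.map_map, ← IsScalarTower.algebraMap_eq, IsRoot.def, eval_map_algebraMap,
    minpoly.aeval]

/-! ### Extensions of odd degree -/

section Extension

variable {K : Type*} [Field K] {d : ℕ} {a : ℕ → K}

/-- In an extension of odd degree, `Tr(x R(x))` restricts to the form of the smaller field. -/
theorem traceForm_algebraMap {E L : Type*} [Field E] [Field L] [Algebra K E] [Algebra K L]
    [Algebra E L] [IsScalarTower K E L] [Algebra (ZMod 2) E] [Algebra (ZMod 2) L] [Finite L]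
    (hodd : Odd (Module.finrank E L)) (x : E) :
    traceForm d a L (algebraMap E L x) = traceForm d a E x := by
  have : Finite E := Finite.of_injective _ (algebraMap E L).injective
  have : IsScalarTower (ZMod 2) E L := .of_algebraMap_eq' (Subsingleton.elim _ _)
  rw [traceForm_apply, traceForm_apply, aeval_algebraMap_apply, ← map_mul,
    ← Algebra.trace_trace (S := E), Algebra.trace_algebraMap, map_nsmul, nsmul_eq_mul,
    (ZMod.natCast_eq_one_iff_odd).2 hodd, one_mul]

/-- The invariant in an extension `L/E` of odd prime degree in which the kernel polynomial gets no
new zeros. The Galois group of `L/E` gives a congruence of the exponential sums modulo `p`, and the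
common radical gives the ratio of their squares. -/
theorem epsilonInv_eq_chi_mul_of_prime {E L : Type*} [Field E] [Field L] [Algebra K E]
    [Algebra K L] [Algebra E L] [IsScalarTower K E L] [Algebra (ZMod 2) E] [Algebra (ZMod 2) L]
    [Finite L] {p t : ℕ} (hp : p.Prime) (hp2 : p ≠ 2) (hL : Module.finrank E L = p)
    (ht : Odd t) (hE : Nat.card E = 2 ^ t)
    (hker : ∀ y : L, aeval y (kernelPoly d a) = 0 → y ∈ Set.range (algebraMap E L)) :
    epsilonInv d a L = ZMod.χ₈ p * epsilonInv d a E := by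
  classical
  have := Fact.mk hp
  have : Finite E := Finite.of_injective _ (algebraMap E L).injective
  have := Fintype.ofFinite E
  have := Fintype.ofFinite L
  have hodd : Odd (Module.finrank E L) := hL ▸ hp.odd_of_ne_two hp2
  have hres : ∀ x : E, traceForm d a L (algebraMap E L x) = traceForm d a E x :=
    traceForm_algebraMap hodd
  have hcong : expSum (traceForm d a L) ≡ expSum (traceForm d a E) [ZMOD p] := by
    have hG : IsPGroup p Gal(L/E) := .of_card (n := 1) (by
      rw [IsGalois.card_aut_eq_finrank, hL, pow_one])
    have h := expSum_modEq_expSum_fixedPoints hG (traceForm d a L) (fun g v ↦ ?_)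
      (algebraMap E L) (algebraMap E L).injective
      (fun v ↦ IsGalois.mem_range_algebraMap_iff_fixed v)
    · simpa only [hres] using h
    · let g₂ : L ≃ₐ[ZMod 2] L := AlgEquiv.ofRingEquiv (f := g.toRingEquiv) fun r ↦
        congrArg (fun f : ZMod 2 →+* L ↦ f r)
          (Subsingleton.elim ((g : L →+* L).comp (algebraMap (ZMod 2) L)) (algebraMap (ZMod 2) L))
      change traceForm d a L (g.restrictScalars K v) = _
      rw [traceForm_apply, traceForm_apply, aeval_algHom_apply (g.restrictScalars K) v, ← map_mul]
      exact Algebra.trace_eq_of_algEquiv g₂ _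
  let SE : Finset E := {y | aeval y (kernelPoly d a) = 0}
  let SL : Finset L := {y | aeval y (kernelPoly d a) = 0}
  have hSE := expSum_sq (traceForm d a E) SE fun y ↦ by
    rw [polar_traceForm_eq_zero_iff]; simp [SE]
  have hSL := expSum_sq (traceForm d a L) SL fun y ↦ by
    rw [polar_traceForm_eq_zero_iff]; simp [SL]
  have hsum : ∑ y ∈ SL, (-1 : ℤ) ^ (traceForm d a L y).val
      = ∑ y ∈ SE, (-1 : ℤ) ^ (traceForm d a E y).val := by
    have himg : SL = SE.image (algebraMap E L) := by
      ext y
      simp only [SL, SE, Finset.mem_filter, Finset.mem_univ, true_and, Finset.mem_image]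
      constructor
      · intro hy
        obtain ⟨z, rfl⟩ := hker y hy
        exact ⟨z, by simpa [aeval_algebraMap_apply] using hy, rfl⟩
      · rintro ⟨z, hz, rfl⟩
        rw [aeval_algebraMap_apply, hz, map_zero]
    rw [himg, Finset.sum_image fun x _ y _ h ↦ (algebraMap E L).injective h]
    simp only [hres]
  have hcE : (Fintype.card E : ℤ) = 2 ^ t := by
    rw [Fintype.card_eq_nat_card, hE]; norm_cast
  have hcL : (Fintype.card L : ℤ) = (2 ^ t) ^ p := by
    rw [Fintype.card_eq_nat_card, Module.natCard_eq_pow_finrank (K := E), hE, hL]; norm_cast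
  rw [hsum, hcL] at hSL
  rw [hcE] at hSE
  obtain ⟨j, hj⟩ := exists_expSum_eq_quadInvariant_mul (traceForm d a E)
  rw [epsilonInv, epsilonInv, quadInvariant_eq_sign_expSum, quadInvariant_eq_sign_expSum]
  exact sign_eq_chi_mul_sign hp hp2 ht hSL hSE hcong
    (quadInvariant_eq_sign_expSum (traceForm d a E) ▸ hj)

/-- A finite extension of finite fields has an intermediate field of every prime index. -/
theorem exists_intermediateField_finrank_eq_prime {L : Type*} [Field L] [Algebra K L] [Finite L]
    {p : ℕ} (hp : p.Prime) (h : p ∣ Module.finrank K L) :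
    ∃ E : IntermediateField K L, Module.finrank E L = p := by
  have := Fact.mk hp
  have : Finite K := Finite.of_injective _ (algebraMap K L).injective
  rw [← IsGalois.card_aut_eq_finrank] at h
  obtain ⟨g, hg⟩ := exists_prime_orderOf_dvd_card' p h
  exact ⟨IntermediateField.fixedField (Subgroup.zpowers g), by
    rw [IntermediateField.finrank_fixedField_eq_card, Nat.card_zpowers, hg]⟩

end Extension

/-! ### Descent along intermediate fields -/

theorem mainTheorem6 (m : ℕ) (hm : Odd m)
    (K : Type*) [Field K] (hK : Nat.card K = 2 ^ m)
    (d : ℕ) (a : ℕ → K) (had : a d ≠ 0)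
    (b N' : ℕ) (hN : kernelDegree d a = 2 ^ b * N') (hN' : Odd N')
    (n : ℕ) (hn : Odd n)
    (L : Type*) [Field L] [Algebra K L] [Algebra (ZMod 2) L]
    (hL : Module.finrank K L = n)
    (L' : Type*) [Field L'] [Algebra K L'] [Algebra (ZMod 2) L']
    (hL' : Module.finrank K L' = Nat.gcd n N') :
    epsilonInv d a L = ZMod.χ₈ ((n * Nat.gcd n N' : ℕ) : ZMod 8) * epsilonInv d a L' := by
  have hKfin : Finite K := Nat.finite_of_card_ne_zero (by rw [hK]; positivity)
  have hgodd : Odd (n.gcd N') := hn.of_dvd_nat (Nat.gcd_dvd_left _ _)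
  have : FiniteDimensional K L' := .of_finrank_pos (hL' ▸ hgodd.pos)
  have : Finite L' := Module.finite_of_finite K
  have := Fintype.ofFinite L'
  induction n using Nat.strong_induction_on generalizing L with
  | _ n ih =>
  have : FiniteDimensional K L := .of_finrank_pos (hL ▸ hn.pos)
  have : Finite L := Module.finite_of_finite K
  have := Fintype.ofFinite L
  rcases eq_or_ne d 0 with rfl | hd
  · -- Both forms are nonzero linear forms.
    simp [epsilonInv, quadInvariant_eq_sign_expSum, expSum_traceForm_zero had]
  have hP := kernelPoly_ne_zero hd had
  have hχ : ∀ k : ℕ, Odd k → ZMod.χ₈ ((k * k : ℕ) : ZMod 8) = 1 := fun k hk ↦ by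
    have h2 : ∀ z : ZMod 8, IsUnit z → ZMod.χ₈ (z * z) = 1 := by decide
    rw [Nat.cast_mul]
    exact h2 _ ((ZMod.isUnit_iff_coprime k 8).2
      (Nat.Coprime.pow_right 3 (Nat.coprime_two_right.2 hk)))
  by_cases hng : n = n.gcd N'
  · have hcard : Module.finrank K L = Module.finrank K L' := by rw [hL, hL', ← hng]
    have : NeZero (Module.finrank K L') := ⟨hL' ▸ hgodd.pos.ne'⟩
    have : CharP K 2 := by
      have : CharP L 2 := charP_of_injective_algebraMap (algebraMap (ZMod 2) L).injective 2
      exact (RingHom.charP_iff _ (algebraMap K L).injective 2).2 this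
    let e : L ≃ₐ[K] L' := (FiniteField.algEquivExtension K 2 _ L hcard).trans
      (FiniteField.algEquivExtension K 2 _ L' rfl).symm
    rw [← hng, hχ n hn, one_mul, epsilonInv_eq_of_algEquiv e]
  · -- Descend along an intermediate field of prime index `p`, where `p` divides `n / gcd(n, N')`.
    obtain ⟨l, hl⟩ := Nat.gcd_dvd_left n N'
    obtain ⟨p, hp, k, rfl⟩ := Nat.exists_prime_and_dvd (n := l) (by
      rintro rfl
      exact hng (by rw [mul_one] at hl; exact hl))
    obtain ⟨g, hg⟩ : ∃ g, g = n.gcd N' := ⟨_, rfl⟩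
    rw [← hg] at hl hL' hgodd ⊢
    have hnp : n = p * (g * k) := by rw [hl]; ring
    obtain ⟨E, hE⟩ := exists_intermediateField_finrank_eq_prime (K := K) (L := L) hp
      (hL ▸ ⟨_, hnp⟩)
    have hKE : Module.finrank K E = g * k := by
      have h := Module.finrank_mul_finrank K E L
      rw [hE, hL, hnp, mul_comm] at h
      exact Nat.eq_of_mul_eq_mul_left hp.pos h
    have hkn : g * k ∣ n := ⟨p, by rw [hnp, mul_comm]⟩
    have hodd : Odd (g * k) := hn.of_dvd_nat hkn
    have hgcd : (g * k).gcd N' = g := Nat.dvd_antisymm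
      ((Nat.gcd_dvd_gcd_of_dvd_left N' hkn).trans hg.symm.dvd)
      (Nat.dvd_gcd ⟨k, rfl⟩ (hg ▸ Nat.gcd_dvd_right n N'))
    have hp2 : p ≠ 2 := by
      rintro rfl
      exact absurd (hn.of_dvd_nat ⟨_, hnp⟩) (by decide)
    have : CharP E 2 := by
      have : CharP L 2 := charP_of_injective_algebraMap (algebraMap (ZMod 2) L).injective 2
      exact (RingHom.charP_iff _ (algebraMap E L).injective 2).2 this
    let := ZMod.algebra E 2
    have hlt : g * k < n := by
      rw [hnp]
      exact (Nat.lt_mul_iff_one_lt_left hodd.pos).2 hp.one_lt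
    have hind := ih (g * k) hlt hodd E hKE (by rw [hgcd, hL']) (by rwa [hgcd])
    have hstep : epsilonInv d a L = ZMod.χ₈ p * epsilonInv d a E := by
      refine epsilonInv_eq_chi_mul_of_prime hp hp2 hE (t := m * (g * k)) (hm.mul hodd)
        (by rw [Module.natCard_eq_pow_finrank (K := K), hK, hKE, ← pow_mul]) fun y hy ↦
          mem_range_algebraMap_of_aeval_eq_zero hP (SplittingField.splits _) (fun r hr hr' ↦ ?_) hy
      -- A divisor of `n` and of `N` is odd, so it divides `N'`, hence `gcd(n, N')`.
      change r ∣ kernelDegree d a at hr'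
      rw [hL] at hr
      rw [hN] at hr'
      have hr2 : r.Coprime (2 ^ b) :=
        Nat.Coprime.pow_right b (Nat.coprime_two_right.2 (hn.of_dvd_nat hr))
      rw [hKE]
      exact (hg ▸ Nat.dvd_gcd hr (hr2.dvd_of_dvd_mul_left hr')).mul_right k
    rw [hstep, hind, hgcd, ← mul_assoc, ← map_mul, ← Nat.cast_mul, ← mul_assoc, ← hnp]
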